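/- **Theorem (attractor–repeller pair decompositions continue).** Let $X\subset\mathbb{R}^n$ be compact and let $F:X\times[-1,1]\to\mathcal{P}(\mathbb{R}^n)$ be upper semicontinuous jointly in $(x,\lambda)$ (for each $p$ and $\varepsilon>0$ there is $\delta>0$ such that $F(q)\subset B_\varepsilon(F(p))$ whenever $|p-q|<\delta$), with non-empty, compact, convex values. For $\lambda\in[-1,1]$, an orbit on $\Phi_\lambda$ is an absolutely continuous solution, with values in $X$, of $\dot x\in F(x,\lambda)$ (for almost every $t$), and $b\in\Phi_\lambda(T,a)$, $T\ge 0$, means that there is an orbit $x:[0,T]\to X$ on $\Phi_\lambda$ with $x(0)=a$, $x(T)=b$. For $N\subset X$, let $\mathrm{Inv}(N,\Phi_\lambda)$ be the set of all $a\in N$ for which there is an orbit $\psi:\mathbb{R}\to N$ on $\Phi_\lambda$ with $\psi(0)=a$. A compact set $N\subset X$ is an isolating neighborhood for $\Phi_\lambda$ if $\mathrm{Inv}(N,\Phi_\lambda)$ is contained in the interior of $N$ relative to $X$. For a compact invariant set $S$ (that is, $S=\mathrm{Inv}(S,\Phi_\lambda)$) write $b\in\Phi_\lambda^S(T,a)$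 if there is an orbit $\psi:[0,T]\to S$ on $\Phi_\lambda$ with $\psi(0)=a$ and $\psi(T)=b$, and for $U\subset S$ put $$\omega_S(U)=\bigcap_{t\ge0}\overline{\Phi_\lambda^S([t,\infty),U)},\qquad \alpha_S(U)=\bigcap_{t<0}\overline{\{b\in S : \Phi_\lambda^S(s,b)\cap U\neq\emptyset\text{ for some } s\ge -t\}}.$$ A set $A\subset S$ is an attractor in $S$ if $\omega_S(U)=A$ for some neighborhood $U$ of $A$ in $S$; a set $R\subset S$ is a repeller in $S$ if $\alpha_S(U)=R$ for some neighborhood $U$ of $R$ in $S$. The pair $(A,R)$ is an attractor–repeller pair decomposition of $S$ if $A$ is an attractor in $S$ and $R$ is its dual repeller, $R=\{x\in S:\omega_S(\{x\})\not\subset A\}$. Let $N$ be an isolating neighborhood for $\Phi_0$, and let $(A_0,R_0)$ be an attractor–repeller pair decomposition of $S_0=\mathrm{Inv}(N,\Phi_0)$. Then there are sets $N_A,N_R\subset N$ with $\mathrm{Inv}(N_A,\Phi_0)=A_0$ and $\mathrm{Inv}(N_R,\Phi_0)=R_0$, and an $\varepsilon>0$, such that for every $\lambda\in[-1,1]$ with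 $|\lambda|<\varepsilon$ the sets $N$, $N_A$ and $N_R$ are isolating neighborhoods for $\Phi_\lambda$ (so that $S_0$, $A_0$, $R_0$ continue to $S_\lambda=\mathrm{Inv}(N,\Phi_\lambda)$, $A_\lambda=\mathrm{Inv}(N_A,\Phi_\lambda)$, $R_\lambda=\mathrm{Inv}(N_R,\Phi_\lambda)$), and $(A_\lambda,R_\lambda)$ is an attractor–repeller pair decomposition of $S_\lambda$; moreover $R_\lambda$ is a repeller in $S_\lambda$. -/

import Mathlib

open Set Topology MeasureTheory

namespace DiffIncl

section SetValued

variable {X Z : Type*} [PseudoMetricSpace X] [PseudoMetricSpace Z]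

/-- Upper semicontinuity of the restriction to `D` of a set-valued map `F`:
for every `x ∈ D` and `ε > 0` there is `δ > 0` such that `F y` lies in the open
`ε`-neighbourhood of `F x` for all `y ∈ D` with `dist x y < δ`. -/
def SetUpperSemicontinuousOn (F : X → Set Z) (D : Set X) : Prop :=
  ∀ x ∈ D, ∀ ε > 0, ∃ δ > 0, ∀ y ∈ D, dist x y < δ → F y ⊆ Metric.thickening ε (F x)

/-- The Filippov conditions for the restriction to `D` of a set-valued map `F`: upper
semicontinuous with compact, convex, non-empty values. -/
structure FilippovOn [AddCommGroup Z] [Module ℝ Z] (F : X → Set Z) (D : Set X) : Prop where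
  usc : SetUpperSemicontinuousOn F D
  compact : ∀ x ∈ D, IsCompact (F x)
  convex : ∀ x ∈ D, Convex ℝ (F x)
  nonempty : ∀ x ∈ D, (F x).Nonempty

end SetValued

variable {n : ℕ}

/-- `x : I → U` is a solution of the differential inclusion `x' ∈ G(x)` on the interval `I`
with values in `U`: it is absolutely continuous (on every compact subinterval of `I`), and
for almost every `t ∈ I` it has a derivative, which belongs to `G (x t)`.
If `Φ` is the multiflow of the inclusion on a set containing `U`, these are
the orbits `I → U` on `Φ`. Only the values of `x` on `I` matter. -/
structure IsOrbit (G : EuclideanSpace ℝ (Fin n) → Set (EuclideanSpace ℝ (Fin n)))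
    (U : Set (EuclideanSpace ℝ (Fin n))) (I : Set ℝ) (x : ℝ → EuclideanSpace ℝ (Fin n)) :
    Prop where
  absCont : ∀ a ∈ I, ∀ b ∈ I, AbsolutelyContinuousOnInterval x a b
  deriv_mem : ∀ᵐ t ∂(volume.restrict I), ∃ v ∈ G (x t), HasDerivAt x v t
  mapsTo : ∀ t ∈ I, x t ∈ U

/-- The multiflow of `x' ∈ G(x)` over `U`: `b ∈ multiflow G U T a` iff `T ≥ 0` and some solution
`x : [0, T] → U` has `x 0 = a` and `x T = b`. If `U` is the whole phase space `X`, this is the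
multiflow `Φ` of the inclusion; if `U = S ⊆ X`, this is the restricted multiflow `Φ^S`. -/
def multiflow (G : EuclideanSpace ℝ (Fin n) → Set (EuclideanSpace ℝ (Fin n)))
    (U : Set (EuclideanSpace ℝ (Fin n))) (T : ℝ) (a : EuclideanSpace ℝ (Fin n)) :
    Set (EuclideanSpace ℝ (Fin n)) :=
  {b | 0 ≤ T ∧ ∃ x, IsOrbit G U (Icc 0 T) x ∧ x 0 = a ∧ x T = b}

/-- The dual multiflow over `U`, at a time `T ≤ 0`. -/
def dualMultiflow (G : EuclideanSpace ℝ (Fin n) → Set (EuclideanSpace ℝ (Fin n)))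
    (U : Set (EuclideanSpace ℝ (Fin n))) (T : ℝ) (a : EuclideanSpace ℝ (Fin n)) :
    Set (EuclideanSpace ℝ (Fin n)) :=
  {b | b ∈ U ∧ a ∈ multiflow G U (-T) b}

/-- `Inv(N, Φ)`: the set of the points of `N` through which there passes an orbit `ℝ → N`. -/
def Inv (G : EuclideanSpace ℝ (Fin n) → Set (EuclideanSpace ℝ (Fin n)))
    (N : Set (EuclideanSpace ℝ (Fin n))) : Set (EuclideanSpace ℝ (Fin n)) :=
  {a | a ∈ N ∧ ∃ x, IsOrbit G N univ x ∧ x 0 = a}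

/-- `N` is an isolating neighbourhood for the multiflow of `x' ∈ G(x)` over the phase space `X`:
`N ⊆ X` is compact and `Inv(N, Φ)` lies in the interior of `N` relative to `X`. -/
structure IsIsolatingNhd (G : EuclideanSpace ℝ (Fin n) → Set (EuclideanSpace ℝ (Fin n)))
    (X N : Set (EuclideanSpace ℝ (Fin n))) : Prop where
  subset : N ⊆ X
  compact : IsCompact N
  inv_subset_interior : ∀ a ∈ Inv G N, N ∈ 𝓝[X] a

/-- `ω_S(U) = ⋂_{t ≥ 0} closure (Φ^S([t, ∞), U))`. -/
def omegaLim (G : EuclideanSpace ℝ (Fin n) → Set (EuclideanSpace ℝ (Fin n)))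
    (S U : Set (EuclideanSpace ℝ (Fin n))) : Set (EuclideanSpace ℝ (Fin n)) :=
  ⋂ t ∈ Ici (0 : ℝ), closure (⋃ s ∈ Ici t, ⋃ a ∈ U, multiflow G S s a)

/-- `α_S(U) = ⋂_{t < 0} closure ((Φ^S)^*((-∞, t], U))`. -/
def alphaLim (G : EuclideanSpace ℝ (Fin n) → Set (EuclideanSpace ℝ (Fin n)))
    (S U : Set (EuclideanSpace ℝ (Fin n))) : Set (EuclideanSpace ℝ (Fin n)) :=
  ⋂ t ∈ Iio (0 : ℝ), closure (⋃ s ∈ Iic t, ⋃ a ∈ U, dualMultiflow G S s a)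

/-- `U` is a neighbourhood of `A` in `S` (for the topology of `S`). -/
def IsNhdIn (S A U : Set (EuclideanSpace ℝ (Fin n))) : Prop :=
  U ⊆ S ∧ ∀ a ∈ A, U ∈ 𝓝[S] a

/-- `A` is an attractor in `S`. -/
def IsAttractor (G : EuclideanSpace ℝ (Fin n) → Set (EuclideanSpace ℝ (Fin n)))
    (S A : Set (EuclideanSpace ℝ (Fin n))) : Prop :=
  A ⊆ S ∧ ∃ U, IsNhdIn S A U ∧ omegaLim G S U = A

/-- `R` is a repeller in `S`. -/
def IsRepeller (G : EuclideanSpace ℝ (Fin n) → Set (EuclideanSpace ℝ (Fin n)))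
    (S R : Set (EuclideanSpace ℝ (Fin n))) : Prop :=
  R ⊆ S ∧ ∃ U, IsNhdIn S R U ∧ alphaLim G S U = R

/-- The dual repeller `{x ∈ S | ω_S(x) ⊄ A}` of `A` in `S`. -/
def dualRepeller (G : EuclideanSpace ℝ (Fin n) → Set (EuclideanSpace ℝ (Fin n)))
    (S A : Set (EuclideanSpace ℝ (Fin n))) : Set (EuclideanSpace ℝ (Fin n)) :=
  {x | x ∈ S ∧ ¬ omegaLim G S {x} ⊆ A}

/-- `(A, R)` is an attractor-repeller pair decomposition of `S`: `A` is an attractor in `S` and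
`R` is its dual repeller in `S`. -/
structure IsAttractorRepellerPair
    (G : EuclideanSpace ℝ (Fin n) → Set (EuclideanSpace ℝ (Fin n)))
    (S A R : Set (EuclideanSpace ℝ (Fin n))) : Prop where
  attractor : IsAttractor G S A
  dual : R = dualRepeller G S A

/-- The right-hand side `x ↦ F(x, l)` of the perturbed inclusion at the parameter value `l`. -/
def perturbed (F : EuclideanSpace ℝ (Fin n) × ℝ → Set (EuclideanSpace ℝ (Fin n))) (l : ℝ) :
    EuclideanSpace ℝ (Fin n) → Set (EuclideanSpace ℝ (Fin n)) :=
  fun x => F (x, l)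

end DiffIncl

namespace DiffIncl

open Filter
open scoped NNReal

variable {n : ℕ}

/-! ### Mean value inclusion for absolutely continuous curves -/

section MeanValue

variable {E : Type*} [NormedAddCommGroup E] [NormedSpace ℝ E]

/-! The engine is compactness: values of `F` over the compact set `X ×ˢ Icc (-1) 1` are uniformly
bounded, so all orbits are Lipschitz with one constant, and pointwise limits of orbits at parameters
tending to `l` are orbits at `l` (`isOrbit_of_tendsto`, from upper semicontinuity, convexity and the
mean value inclusion). Limits along an ultrafilter always exist, so an open condition at parameter
`0` can be carried to nearby parameters by contradiction.

Let `U` be a neighbourhood with `ω_S(U) = A₀` and put `K = closure (S \ U)`, a compact set disjoint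
from `A₀` that contains the dual repeller. Take `N_A`, `N_R` to be the traces on `N` of disjoint
closed `δ`-neighbourhoods of `A₀` and `K`. Two properties survive perturbation: orbits in `S_λ`
starting in `N_A` are back in `N_A` at every time after a fixed `T` (`eventually_multiflow_subset`),
and forward orbits in `S_λ` that stay in `closure (S_λ \ N_A)` start in `N_R`
(`eventually_forward_orbit_mem`).

These two properties, with isolation and disjointness, suffice at each `λ`. The first puts `ω(N_A ∩
S_λ)` inside `N_A`; being invariant, it equals `A_λ`. The second puts the dual repeller inside
`N_R`; being invariant, it lies in `R_λ`. Conversely, orbits in `R_λ` stay away from `A_λ`, hence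
lie in the dual repeller. The same compactness identifies the dual repeller with `α(N_R ∩ S_λ)`. -/

theorem absolutelyContinuousOnInterval_clm_comp {x : ℝ → E} {a b : ℝ}
    (hx : AbsolutelyContinuousOnInterval x a b) (φ : E →L[ℝ] ℝ) :
    AbsolutelyContinuousOnInterval (fun t => φ (x t)) a b := by
  refine squeeze_zero (fun E => Finset.sum_nonneg fun i _ => dist_nonneg) (fun E => ?_)
    (by simpa using! Tendsto.const_mul ‖φ‖ hx)
  rw [Finset.mul_sum]
  exact Finset.sum_le_sum fun i _ => φ.lipschitz.dist_le_mul _ _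

theorem clm_sub_le_of_ae_hasDerivAt {x : ℝ → E} {a b c : ℝ} {C : Set E} (hab : a ≤ b)
    (hx : AbsolutelyContinuousOnInterval x a b)
    (hd : ∀ᵐ t, t ∈ Icc a b → ∃ v ∈ C, HasDerivAt x v t) (φ : E →L[ℝ] ℝ)
    (hφ : ∀ v ∈ C, φ v ≤ c) : φ (x b) - φ (x a) ≤ (b - a) * c := by
  have hac := absolutelyContinuousOnInterval_clm_comp hx φ
  rw [← hac.integral_deriv_eq_sub]
  have : ∫ _t in a..b, c = (b - a) * c := by simp
  rw [← this]
  refine intervalIntegral.integral_mono_ae_restrict hab hac.intervalIntegrable_deriv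
    intervalIntegrable_const ?_
  refine (ae_restrict_iff' measurableSet_Icc).2 ?_
  filter_upwards [hd] with t ht htI
  obtain ⟨v, hv, hvd⟩ := ht htI
  have := (φ.hasFDerivAt.comp_hasDerivAt t hvd).deriv
  exact (le_of_eq this).trans (hφ v hv)

/-- The difference quotient of an absolutely continuous curve lies in every closed convex set that
contains almost all its derivatives. -/
theorem slope_mem_of_ae_hasDerivAt {x : ℝ → E} {a b : ℝ} {C : Set E} (hC : IsClosed C)
    (hconv : Convex ℝ C) (hab : a < b) (hx : AbsolutelyContinuousOnInterval x a b)
    (hd : ∀ᵐ t, t ∈ Icc a b → ∃ v ∈ C, HasDerivAt x v t) : (b - a)⁻¹ • (x b - x a) ∈ C := by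
  by_contra h
  obtain ⟨φ, u, hu, hlt⟩ := geometric_hahn_banach_closed_point hconv hC h
  have := clm_sub_le_of_ae_hasDerivAt hab.le hx hd φ fun v hv => (hu v hv).le
  rw [map_smul, map_sub, smul_eq_mul] at hlt
  have hpos : 0 < b - a := sub_pos.2 hab
  have h2 := mul_lt_mul_of_pos_left hlt hpos
  rw [mul_inv_cancel_left₀ hpos.ne'] at h2
  linarith

theorem dist_le_of_ae_hasDerivAt {x : ℝ → E} {a b : ℝ} {M : ℝ} (hab : a ≤ b)
    (hx : AbsolutelyContinuousOnInterval x a b)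
    (hd : ∀ᵐ t, t ∈ Icc a b → ∃ v, ‖v‖ ≤ M ∧ HasDerivAt x v t) :
    dist (x a) (x b) ≤ M * dist a b := by
  rcases hab.eq_or_lt with rfl | hab
  · simp
  have := slope_mem_of_ae_hasDerivAt Metric.isClosed_closedBall (convex_closedBall (0 : E) M) hab hx
    (by simpa using hd)
  have hpos : 0 < b - a := sub_pos.2 hab
  rw [mem_closedBall_zero_iff, norm_smul, norm_inv, Real.norm_of_nonneg hpos.le,
    inv_mul_le_iff₀ hpos] at this
  rw [dist_comm, dist_eq_norm, dist_comm, Real.dist_eq, abs_of_pos hpos]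
  linarith

end MeanValue

/-! ### Orbits as Lipschitz curves: restriction, time shift, concatenation -/

section Orbits

variable {G : EuclideanSpace ℝ (Fin n) → Set (EuclideanSpace ℝ (Fin n))}
  {U V : Set (EuclideanSpace ℝ (Fin n))} {I J : Set ℝ} {x y : ℝ → EuclideanSpace ℝ (Fin n)}
  {M : ℝ≥0}

theorem IsOrbit.mono (h : IsOrbit G U I x) (hJ : J ⊆ I) (hV : ∀ t ∈ J, x t ∈ V) :
    IsOrbit G V J x :=
  ⟨fun a ha b hb => h.absCont a (hJ ha) b (hJ hb), ae_restrict_of_ae_restrict_of_subset hJ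
    h.deriv_mem, hV⟩

theorem IsOrbit.mono_time (h : IsOrbit G U I x) (hJ : J ⊆ I) : IsOrbit G U J x :=
  h.mono hJ fun t ht => h.mapsTo t (hJ ht)

theorem IsOrbit.mono_space (h : IsOrbit G U I x) (hV : U ⊆ V) : IsOrbit G V I x :=
  h.mono Subset.rfl fun t ht => hV (h.mapsTo t ht)

/-- Bounded velocities turn absolute continuity into a Lipschitz condition with a constant
independent of the orbit. Unlike absolute continuity, this survives pointwise limits, and it is easy
to glue. -/
theorem isOrbit_iff (hI : I.OrdConnected) (hM : ∀ p ∈ U, ∀ v ∈ G p, ‖v‖ ≤ M) :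
    IsOrbit G U I x ↔ LipschitzOnWith M x I ∧
      (∀ᵐ t, t ∈ I → ∃ v ∈ G (x t), HasDerivAt x v t) ∧ ∀ t ∈ I, x t ∈ U := by
  constructor
  · intro h
    have hd := (ae_restrict_iff' hI.measurableSet).1 h.deriv_mem
    refine ⟨?_, hd, h.mapsTo⟩
    refine LipschitzOnWith.of_dist_le_mul fun a ha b hb => ?_
    wlog hab : a ≤ b generalizing a b
    · rw [dist_comm, dist_comm a]
      exact this b hb a ha (le_of_not_ge hab)
    refine dist_le_of_ae_hasDerivAt hab (h.absCont a ha b hb) ?_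
    filter_upwards [hd] with t ht htI
    have htI' := hI.out ha hb htI
    obtain ⟨v, hv, hvd⟩ := ht htI'
    exact ⟨v, hM _ (h.mapsTo t htI') v hv, hvd⟩
  · rintro ⟨hL, hd, hU⟩
    refine ⟨fun a ha b hb => ?_, (ae_restrict_iff' hI.measurableSet).2 hd, hU⟩
    exact (hL.mono (hI.uIcc_subset ha hb)).absolutelyContinuousOnInterval

theorem IsOrbit.shift (hI : I.OrdConnected) (hM : ∀ p ∈ U, ∀ v ∈ G p, ‖v‖ ≤ M)
    (h : IsOrbit G U I x) (c : ℝ) : IsOrbit G U ((· + c) ⁻¹' I) fun t => x (t + c) := by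
  have hJ : ((· + c) ⁻¹' I).OrdConnected := hI.preimage_mono fun a b hab => by simpa using hab
  rw [isOrbit_iff hI hM] at h
  obtain ⟨hL, hd, hU⟩ := h
  refine (isOrbit_iff hJ hM).2 ⟨?_, ?_, fun t ht => hU _ ht⟩
  · refine LipschitzOnWith.of_dist_le_mul fun a ha b hb => ?_
    simpa using hL.dist_le_mul _ ha _ hb
  · filter_upwards [(measurePreserving_add_right volume c).quasiMeasurePreserving.ae hd]
      with t ht htI
    obtain ⟨v, hv, hvd⟩ := ht htI
    exact ⟨v, hv, hvd.comp_add_const t c⟩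

theorem IsOrbit.concat (hI : I.OrdConnected) (hM : ∀ p ∈ U, ∀ v ∈ G p, ‖v‖ ≤ M) {c : ℝ}
    (hc : c ∈ I) (hx : IsOrbit G U (I ∩ Iic c) x) (hy : IsOrbit G U (I ∩ Ici c) y)
    (hxy : x c = y c) : IsOrbit G U I fun t => if t ≤ c then x t else y t := by
  rw [isOrbit_iff (hI.inter ordConnected_Iic) hM] at hx
  rw [isOrbit_iff (hI.inter ordConnected_Ici) hM] at hy
  obtain ⟨hLx, hdx, hUx⟩ := hx
  obtain ⟨hLy, hdy, hUy⟩ := hy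
  refine (isOrbit_iff hI hM).2 ⟨?_, ?_, fun t ht => ?_⟩
  · refine LipschitzOnWith.of_dist_le_mul fun a ha b hb => ?_
    wlog hab : a ≤ b generalizing a b
    · rw [dist_comm, dist_comm a]
      exact this b hb a ha (le_of_not_ge hab)
    by_cases h1 : b ≤ c
    · rw [if_pos (hab.trans h1), if_pos h1]
      exact hLx.dist_le_mul _ ⟨ha, hab.trans h1⟩ _ ⟨hb, h1⟩
    by_cases h2 : a ≤ c
    · rw [if_pos h2, if_neg h1]
      have e1 := hLx.dist_le_mul _ ⟨ha, h2⟩ _ ⟨hc, le_refl c⟩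
      have e2 := hLy.dist_le_mul _ ⟨hc, le_refl c⟩ _ ⟨hb, (not_le.1 h1).le⟩
      have e3 : dist a b = dist a c + dist c b := by
        have h1 := not_le.1 h1
        rw [Real.dist_eq, Real.dist_eq, Real.dist_eq, abs_of_nonpos, abs_of_nonpos, abs_of_nonpos]
          <;> linarith
      rw [hxy] at e1
      rw [e3, mul_add]
      exact (dist_triangle _ (y c) _).trans (add_le_add e1 e2)
    · rw [if_neg h1, if_neg h2]
      exact hLy.dist_le_mul _ ⟨ha, (not_le.1 h2).le⟩ _ ⟨hb, (not_le.1 h1).le⟩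
  · filter_upwards [hdx, hdy, compl_mem_ae_iff.2 (measure_singleton (μ := volume) c)]
      with t h1 h2 htc htI
    rcases lt_or_gt_of_ne (show t ≠ c from htc) with htc | htc
    · obtain ⟨v, hv, hvd⟩ := h1 ⟨htI, htc.le⟩
      refine ⟨v, by simpa [htc.le] using hv, hvd.congr_of_eventuallyEq ?_⟩
      filter_upwards [Iio_mem_nhds htc] with s hs
      exact if_pos (le_of_lt hs)
    · obtain ⟨v, hv, hvd⟩ := h2 ⟨htI, htc.le⟩
      refine ⟨v, by simpa [not_le.2 htc] using hv, hvd.congr_of_eventuallyEq ?_⟩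
      filter_upwards [Ioi_mem_nhds htc] with s hs
      exact if_neg (not_le.2 hs)
  · split_ifs with h
    · exact hUx t ⟨ht, h⟩
    · exact hUy t ⟨ht, (not_le.1 h).le⟩

end Orbits

/-! ### Limits of orbits under varying parameter -/

section Limits

variable {X : Set (EuclideanSpace ℝ (Fin n))}
  {F : EuclideanSpace ℝ (Fin n) × ℝ → Set (EuclideanSpace ℝ (Fin n))}

/-- Near `p` the values lie in the 1-neighbourhood of the bounded set `F p`; compactness of `D`
leaves finitely many such bounds. -/
theorem FilippovOn.exists_bound {Y Z : Type*} [PseudoMetricSpace Y] [SeminormedAddCommGroup Z]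
    [Module ℝ Z] {F : Y → Set Z} {D : Set Y} (hF : FilippovOn F D) (hD : IsCompact D) :
    ∃ M : ℝ≥0, ∀ p ∈ D, ∀ v ∈ F p, ‖v‖ ≤ M := by
  refine hD.induction_on (p := fun s => ∃ M : ℝ≥0, ∀ p ∈ s, ∀ v ∈ F p, ‖v‖ ≤ M) ⟨0, by simp⟩
    ?_ ?_ ?_
  · rintro s t hst ⟨M, hM⟩
    exact ⟨M, fun p hp => hM p (hst hp)⟩
  · rintro s t ⟨M, hM⟩ ⟨M', hM'⟩
    refine ⟨max M M', fun p hp v hv => ?_⟩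
    rw [NNReal.coe_max]
    rcases hp with hp | hp
    · exact le_max_of_le_left (hM p hp v hv)
    · exact le_max_of_le_right (hM' p hp v hv)
  · intro p hp
    obtain ⟨δ, hδ, h⟩ := hF.usc p hp 1 one_pos
    obtain ⟨M, hM⟩ := ((hF.compact p hp).isBounded.thickening (δ := 1)).exists_norm_le
    refine ⟨Metric.ball p δ ∩ D,
      inter_comm D _ ▸ inter_mem_nhdsWithin _ (Metric.ball_mem_nhds p hδ),
      M.toNNReal, fun q hq v hv => (hM v (h q hq.2 ?_ hv)).trans (Real.le_coe_toNNReal M)⟩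
    rw [dist_comm]
    exact hq.1

set_option maxHeartbeats 1000000 in
/-- Pointwise limits of orbits are orbits. -/
theorem isOrbit_of_tendsto (hX : IsCompact X) (hF : FilippovOn F (X ×ˢ Icc (-1 : ℝ) 1))
    {ι : Type*} {𝓕 : Filter ι} [𝓕.NeBot] {x : ι → ℝ → EuclideanSpace ℝ (Fin n)} {lam : ι → ℝ}
    {l : ℝ} {J : ι → Set ℝ} {I : Set ℝ} (hI : I.OrdConnected)
    (hlam : ∀ k, lam k ∈ Icc (-1 : ℝ) 1) (hl : Tendsto lam 𝓕 (𝓝 l))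
    (hx : ∀ k, IsOrbit (perturbed F (lam k)) X (J k) (x k))
    (hJ : ∀ a ∈ I, ∀ b ∈ I, ∀ᶠ k in 𝓕, Icc a b ⊆ J k) {y : ℝ → EuclideanSpace ℝ (Fin n)}
    (hy : ∀ t ∈ I, Tendsto (fun k => x k t) 𝓕 (𝓝 (y t))) : IsOrbit (perturbed F l) X I y := by
  obtain ⟨M, hM⟩ := hF.exists_bound (hX.prod isCompact_Icc)
  have hl1 : l ∈ Icc (-1 : ℝ) 1 := isClosed_Icc.mem_of_tendsto hl (Eventually.of_forall hlam)
  have hM' : ∀ l ∈ Icc (-1 : ℝ) 1, ∀ p ∈ X, ∀ v ∈ perturbed F l p, ‖v‖ ≤ M :=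
    fun l hl p hp v hv => hM (p, l) ⟨hp, hl⟩ v hv
  have hxI : ∀ a ∈ I, ∀ b ∈ I, ∀ᶠ k in 𝓕, LipschitzOnWith M (x k) (Icc a b) ∧
      (∀ᵐ t, t ∈ Icc a b → ∃ v ∈ perturbed F (lam k) (x k t), HasDerivAt (x k) v t) ∧
      (∀ t ∈ Icc a b, x k t ∈ X) := fun a ha b hb => (hJ a ha b hb).mono fun k hk =>
    (isOrbit_iff ordConnected_Icc (hM' _ (hlam k))).1 ((hx k).mono_time hk)
  have hyX : ∀ t ∈ I, y t ∈ X := fun t ht => hX.isClosed.mem_of_tendsto (hy t ht)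
    ((hxI t ht t ht).mono fun k hk => hk.2.2 t ⟨le_rfl, le_rfl⟩)
  have hyL : LipschitzOnWith M y I := by
    refine LipschitzOnWith.of_dist_le_mul fun a ha b hb => ?_
    wlog hab : a ≤ b generalizing a b
    · rw [dist_comm, dist_comm a]
      exact this b hb a ha (le_of_not_ge hab)
    exact le_of_tendsto ((hy a ha).dist (hy b hb)) ((hxI a ha b hb).mono fun k hk =>
      hk.1.dist_le_mul _ ⟨le_rfl, hab⟩ _ ⟨hab, le_rfl⟩)
  refine (isOrbit_iff hI (hM' l hl1)).2 ⟨hyL, ?_, hyX⟩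
  -- An interval has null frontier, so almost every time of `I` is interior, where Rademacher's
  -- theorem gives a two-sided derivative of the limit.
  have hfr : volume (frontier I) = 0 := (convex_iff_ordConnected.2 hI).addHaar_frontier volume
  filter_upwards [hyL.ae_differentiableWithinAt_of_mem, compl_mem_ae_iff.2 hfr] with t ht htf htI
  have hint : I ∈ 𝓝 t := by
    rw [← mem_interior_iff_mem_nhds]
    by_contra h
    exact htf ⟨subset_closure htI, h⟩
  have hyd : HasDerivAt y (deriv y t) t := ((ht htI).differentiableAt hint).hasDerivAt
  refine ⟨deriv y t, ?_, hyd⟩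
  have hp : (y t, l) ∈ X ×ˢ Icc (-1 : ℝ) 1 := ⟨hyX t htI, hl1⟩
  have hcl : IsClosed (F (y t, l)) := (hF.compact _ hp).isClosed
  change deriv y t ∈ F (y t, l)
  -- It is enough to trap the derivative in every closed `ε`-neighbourhood of `F (y t, l)`; these
  -- are closed and convex, so they pass from velocities of `x k` to slopes of `x k`, to slopes of
  -- `y`, and to `deriv y t`.
  rw [← hcl.closure_eq, Metric.closure_eq_iInter_cthickening]
  simp only [mem_iInter]
  intro ε hε
  obtain ⟨δ, hδ, hδF⟩ := hF.usc _ hp ε hε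
  have hslope : Tendsto (slope y t) (𝓝[>] t) (𝓝 (deriv y t)) :=
    (hasDerivAt_iff_tendsto_slope.1 hyd).mono_left
      (nhdsWithin_mono t fun s (hs : t < s) => ne_of_gt hs)
  refine Metric.isClosed_cthickening.mem_of_tendsto hslope ?_
  -- Within this time an `M`-Lipschitz curve moves at most `δ / 2`; the other `δ / 2` pays for the
  -- distance from `x k t` to `y t`. The `+ 1` covers `M = 0`.
  have hpos : 0 < δ / (2 * (M + 1)) := by positivity
  filter_upwards [Ioo_mem_nhdsGT (show t < t + δ / (2 * (M + 1)) by linarith),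
    mem_nhdsWithin_of_mem_nhds hint] with s hs hsI
  have hsl : Tendsto (fun k => (s - t)⁻¹ • (x k s - x k t)) 𝓕 (𝓝 (slope y t s)) :=
    ((hy s hsI).sub (hy t htI)).const_smul _
  refine Metric.isClosed_cthickening.mem_of_tendsto hsl ?_
  filter_upwards [hxI t htI s hsI, Metric.tendsto_nhds.1 (hy t htI) (δ / 2) (by positivity),
    Metric.tendsto_nhds.1 hl δ hδ] with k hk hkt hkl
  refine slope_mem_of_ae_hasDerivAt Metric.isClosed_cthickening
    ((hF.convex _ hp).cthickening ε) hs.1 ?_ ?_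
  · refine LipschitzOnWith.absolutelyContinuousOnInterval (K := M) ?_
    rw [uIcc_of_le hs.1.le]
    exact hk.1
  · filter_upwards [hk.2.1] with r hr hrI
    obtain ⟨v, hv, hvd⟩ := hr hrI
    refine ⟨v, Metric.thickening_subset_cthickening _ _
      (hδF (x k r, lam k) ⟨hk.2.2 r hrI, hlam k⟩ ?_ hv), hvd⟩
    rw [dist_comm, Prod.dist_eq]
    refine max_lt ?_ hkl
    have h1 := hk.1.dist_le_mul _ hrI _ (left_mem_Icc.2 hs.1.le)
    have h2 : (M : ℝ) * dist r t ≤ M * (δ / (2 * (M + 1))) := by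
      gcongr
      rw [Real.dist_eq, abs_of_nonneg (sub_nonneg.2 hrI.1)]
      linarith [hrI.2, hs.2]
    have h3 : (M : ℝ) * (δ / (2 * (M + 1))) ≤ δ / 2 := by
      rw [mul_div_assoc', div_le_div_iff₀ (by positivity) (by positivity)]
      nlinarith [M.2]
    calc dist (x k r) (y t) ≤ dist (x k r) (x k t) + dist (x k t) (y t) := dist_triangle _ _ _
      _ < δ := by linarith

/-- Compactness of orbits: along an ultrafilter, orbits have a pointwise limit, which is an
orbit. -/
theorem exists_isOrbit_tendsto (hX : IsCompact X) (hF : FilippovOn F (X ×ˢ Icc (-1 : ℝ) 1))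
    {ι : Type*} {𝓤 : Ultrafilter ι} {x : ι → ℝ → EuclideanSpace ℝ (Fin n)} {lam : ι → ℝ}
    {l : ℝ} {J : ι → Set ℝ} {I : Set ℝ} (hI : I.OrdConnected)
    (hlam : ∀ k, lam k ∈ Icc (-1 : ℝ) 1) (hl : Tendsto lam 𝓤 (𝓝 l))
    (hx : ∀ k, IsOrbit (perturbed F (lam k)) X (J k) (x k))
    (hJ : ∀ a ∈ I, ∀ b ∈ I, ∀ᶠ k in 𝓤, Icc a b ⊆ J k) :
    ∃ y, IsOrbit (perturbed F l) X I y ∧ ∀ t ∈ I, Tendsto (fun k => x k t) 𝓤 (𝓝 (y t)) := by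
  -- An ultrafilter converges at all times simultaneously, so no subsequence has to be extracted.
  have key : ∀ t, ∃ p, t ∈ I → Tendsto (fun k => x k t) 𝓤 (𝓝 p) := by
    intro t
    by_cases ht : t ∈ I
    · obtain ⟨p, -, hp⟩ := hX.ultrafilter_le_nhds (𝓤.map fun k => x k t) (by
        rw [le_principal_iff]
        exact (hJ t ht t ht).mono fun k hk => (hx k).mapsTo t (hk ⟨le_rfl, le_rfl⟩))
      exact ⟨p, fun _ => hp⟩
    · exact ⟨0, fun h => absurd h ht⟩
  choose y hy using key
  exact ⟨y, isOrbit_of_tendsto hX hF hI hlam hl hx hJ hy, hy⟩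

end Limits

/-! ### Invariant sets, ω-limits and the dual repeller -/

section Invariant

variable {G : EuclideanSpace ℝ (Fin n) → Set (EuclideanSpace ℝ (Fin n))}
  {N A S U K : Set (EuclideanSpace ℝ (Fin n))} {x z : ℝ → EuclideanSpace ℝ (Fin n)} {M : ℝ≥0}

/-- Through each point of `A` there passes an orbit `ℝ → A`. -/
def IsInvariant (G : EuclideanSpace ℝ (Fin n) → Set (EuclideanSpace ℝ (Fin n)))
    (A : Set (EuclideanSpace ℝ (Fin n))) : Prop :=
  ∀ a ∈ A, ∃ x, IsOrbit G A univ x ∧ x 0 = a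

theorem IsInvariant.subset_inv (h : IsInvariant G A) (hN : A ⊆ N) : A ⊆ Inv G N := fun a ha => by
  obtain ⟨x, hx, hx0⟩ := h a ha
  exact ⟨hN ha, x, hx.mono_space hN, hx0⟩

theorem Inv_mono (h : A ⊆ N) : Inv G A ⊆ Inv G N := fun a ha => by
  obtain ⟨haA, x, hx, hx0⟩ := ha
  exact ⟨h haA, x, hx.mono_space h, hx0⟩

theorem IsOrbit.mem_inv (hM : ∀ p ∈ N, ∀ v ∈ G p, ‖v‖ ≤ M) (hx : IsOrbit G N univ x) (t : ℝ) :
    x t ∈ Inv G N :=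
  ⟨hx.mapsTo t trivial, fun s => x (s + t), by simpa using hx.shift ordConnected_univ hM t,
    by simp⟩

theorem isInvariant_inv (hM : ∀ p ∈ N, ∀ v ∈ G p, ‖v‖ ≤ M) : IsInvariant G (Inv G N) :=
  fun _ ⟨_, x, hx, hx0⟩ => ⟨x, hx.mono Subset.rfl fun t _ => hx.mem_inv hM t, hx0⟩

theorem IsOrbit.shift_Ici (hM : ∀ p ∈ S, ∀ v ∈ G p, ‖v‖ ≤ M) {I : Set ℝ} (hI : I.OrdConnected)
    (hx : IsOrbit G S I x) {c : ℝ} (hc : Ici c ⊆ I) :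
    IsOrbit G S (Ici 0) fun t => x (t + c) :=
  (hx.shift hI hM c).mono_time fun t (ht : 0 ≤ t) => hc (by simpa using ht)

theorem IsOrbit.mem_multiflow (hM : ∀ p ∈ S, ∀ v ∈ G p, ‖v‖ ≤ M) {I : Set ℝ} {s t : ℝ}
    (hx : IsOrbit G S I x) (hst : s ≤ t) (hI : Icc s t ⊆ I) :
    x t ∈ multiflow G S (t - s) (x s) := by
  refine ⟨sub_nonneg.2 hst, fun r => x (r + s), ?_, by simp, by simp⟩
  refine ((hx.mono_time hI).shift ordConnected_Icc hM s).mono_time fun r hr => ⟨?_, ?_⟩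
  · linarith [hr.1]
  · linarith [hr.2]

/-- In an invariant set, orbits extend to infinite forward time. -/
theorem IsInvariant.exists_extension (hS : IsInvariant G S) (hM : ∀ p ∈ S, ∀ v ∈ G p, ‖v‖ ≤ M)
    {T : ℝ} (hT : 0 ≤ T) (hx : IsOrbit G S (Icc 0 T) x) :
    ∃ z, IsOrbit G S (Ici 0) z ∧ EqOn z x (Icc 0 T) := by
  obtain ⟨w, hw, hw0⟩ := hS _ (hx.mapsTo T ⟨hT, le_rfl⟩)
  refine ⟨fun t => if t ≤ T then x t else w (t + -T), ?_, fun t ht => if_pos ht.2⟩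
  refine IsOrbit.concat (y := fun t => w (t + -T)) ordConnected_Ici hM hT ?_ ?_ (by simp [hw0])
  · exact hx.mono_time fun t ht => ht
  · exact (hw.shift ordConnected_univ hM (-T)).mono_time fun t _ => trivial

theorem mem_omegaLim_of_tendsto {ι : Type*} {𝓕 : Filter ι} [𝓕.NeBot]
    {a b : ι → EuclideanSpace ℝ (Fin n)} {t : ι → ℝ} {y : EuclideanSpace ℝ (Fin n)}
    (ht : Tendsto t 𝓕 atTop) (ha : ∀ᶠ k in 𝓕, a k ∈ U)
    (hb : ∀ᶠ k in 𝓕, b k ∈ multiflow G S (t k) (a k)) (hy : Tendsto b 𝓕 (𝓝 y)) :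
    y ∈ omegaLim G S U := by
  simp only [omegaLim, mem_iInter]
  intro T _
  refine mem_closure_of_tendsto hy ?_
  filter_upwards [ht.eventually_ge_atTop T, ha, hb] with k h1 h2 h3
  exact mem_iUnion₂.2 ⟨t k, h1, mem_iUnion₂.2 ⟨a k, h2, h3⟩⟩

theorem exists_seq_of_mem_omegaLim {y : EuclideanSpace ℝ (Fin n)} (hy : y ∈ omegaLim G S U) :
    ∃ (x : ℕ → ℝ → EuclideanSpace ℝ (Fin n)) (t : ℕ → ℝ), (∀ k : ℕ, (k : ℝ) ≤ t k) ∧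
      (∀ k, IsOrbit G S (Icc 0 (t k)) (x k)) ∧ (∀ k, x k 0 ∈ U) ∧
      Tendsto (fun k => x k (t k)) atTop (𝓝 y) := by
  have key : ∀ k : ℕ, ∃ (x : ℝ → EuclideanSpace ℝ (Fin n)) (t : ℝ), (k : ℝ) ≤ t ∧
      IsOrbit G S (Icc 0 t) x ∧ x 0 ∈ U ∧ dist (x t) y < 1 / ((k : ℝ) + 1) := by
    intro k
    have hk : y ∈ closure (⋃ s ∈ Ici (k : ℝ), ⋃ a ∈ U, multiflow G S s a) :=
      mem_iInter₂.1 hy (k : ℝ) (mem_Ici.2 k.cast_nonneg)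
    obtain ⟨b, hb, hd⟩ := Metric.mem_closure_iff.1 hk _ (Nat.one_div_pos_of_nat (n := k))
    simp only [mem_iUnion] at hb
    obtain ⟨t, ht, a, ha, -, x, hx, rfl, rfl⟩ := hb
    exact ⟨x, t, ht, hx, ha, by rwa [dist_comm]⟩
  choose x t h1 h2 h3 h4 using key
  refine ⟨x, t, h1, h2, h3, tendsto_iff_dist_tendsto_zero.2 ?_⟩
  exact squeeze_zero (fun _ => dist_nonneg) (fun k => (h4 k).le)
    tendsto_one_div_add_atTop_nhds_zero_nat

theorem multiflow_subset {T : ℝ} {a : EuclideanSpace ℝ (Fin n)} : multiflow G S T a ⊆ S := by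
  rintro _ ⟨hT, x, hx, -, rfl⟩
  exact hx.mapsTo T ⟨hT, le_rfl⟩

/-- A full orbit through `a` in `A` reaches `a` from its position at time `-k`, a point of `U`, for
every `k`. -/
theorem IsInvariant.subset_omegaLim (hA : IsInvariant G A) (hM : ∀ p ∈ S, ∀ v ∈ G p, ‖v‖ ≤ M)
    (hAS : A ⊆ S) (hAU : A ⊆ U) : A ⊆ omegaLim G S U := by
  intro a ha
  obtain ⟨x, hx, rfl⟩ := hA a ha
  refine mem_omegaLim_of_tendsto (𝓕 := atTop) (a := fun k : ℕ => x (-k)) (b := fun _ => x 0)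
    (t := fun k : ℕ => (k : ℝ)) tendsto_natCast_atTop_atTop
    (Eventually.of_forall fun k => hAU (hx.mapsTo _ trivial)) (Eventually.of_forall fun k => ?_)
    tendsto_const_nhds
  simpa using (hx.mono_space hAS).mem_multiflow hM (s := -(k : ℝ)) (t := 0) (by simp)
    (subset_univ _)

theorem isClosed_omegaLim : IsClosed (omegaLim G S U) :=
  isClosed_biInter fun _ _ => isClosed_closure

/-- Uniform attraction: an open neighbourhood of `ω_S(U)` absorbs `U` after some time. -/
theorem exists_time_multiflow_subset (hS : IsCompact S) {O : Set (EuclideanSpace ℝ (Fin n))}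
    (hO : IsOpen O) (h : omegaLim G S U ⊆ O) :
    ∃ T > (0 : ℝ), ∀ t ≥ T, ∀ a ∈ U, multiflow G S t a ⊆ O := by
  by_contra! hcon
  have key : ∀ k : ℕ, ∃ t ≥ (k : ℝ) + 1, ∃ a ∈ U, ∃ b ∈ multiflow G S t a, b ∉ O := by
    intro k
    obtain ⟨t, ht, a, ha, hb⟩ := hcon (k + 1) (by positivity)
    exact ⟨t, ht, a, ha, not_subset.1 hb⟩
  choose t ht a ha b hb hbO using key
  obtain ⟨y, -, hy⟩ := hS.ultrafilter_le_nhds ((hyperfilter ℕ).map b) (by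
    rw [le_principal_iff]
    exact mem_map.2 (Eventually.of_forall fun k : ℕ => multiflow_subset (hb k)))
  have ht' : Tendsto t (hyperfilter ℕ) atTop := by
    refine Tendsto.mono_left ?_ Nat.hyperfilter_le_atTop
    exact tendsto_atTop_mono (fun k => by linarith [ht k]) tendsto_natCast_atTop_atTop
  have hyO := h (mem_omegaLim_of_tendsto ht' (Eventually.of_forall ha) (Eventually.of_forall hb) hy)
  obtain ⟨k, hk⟩ := (Tendsto.eventually (show Tendsto b (hyperfilter ℕ) (𝓝 y) from hy)
    (hO.mem_nhds hyO)).exists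
  exact hbO k hk

/-- Any accumulation point of `z k` lies in `ω_S(z 0)` and in the closed set `K`, hence outside `A`.
This is the criterion used for membership in the dual repeller throughout. -/
theorem mem_dualRepeller_of_eventually_mem (hM : ∀ p ∈ S, ∀ v ∈ G p, ‖v‖ ≤ M) (hS : IsCompact S)
    (hK : IsClosed K) (hKA : Disjoint K A) (hz : IsOrbit G S (Ici 0) z)
    (hzK : ∀ᶠ t in atTop, z t ∈ K) : z 0 ∈ dualRepeller G S A := by
  refine ⟨hz.mapsTo 0 (mem_Ici.2 le_rfl), fun hsub => ?_⟩
  have hle := Nat.hyperfilter_le_atTop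
  obtain ⟨y, -, hy⟩ := hS.ultrafilter_le_nhds ((hyperfilter ℕ).map fun k : ℕ => z k) (by
    rw [le_principal_iff]
    exact mem_map.2 (Eventually.of_forall fun k : ℕ => hz.mapsTo k (mem_Ici.2 k.cast_nonneg)))
  have hy' : Tendsto (fun k : ℕ => z k) (hyperfilter ℕ) (𝓝 y) := hy
  have hyK : y ∈ K := hK.mem_of_tendsto hy'
    (hle (tendsto_natCast_atTop_atTop.eventually hzK))
  refine disjoint_left.1 hKA hyK (hsub ?_)
  refine mem_omegaLim_of_tendsto (t := fun k : ℕ => (k : ℝ)) (a := fun _ => z 0)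
    (tendsto_natCast_atTop_atTop.mono_left hle) (Eventually.of_forall fun _ => rfl)
    (Eventually.of_forall fun k => ?_) hy'
  simpa using hz.mem_multiflow hM (s := 0) (t := k) k.cast_nonneg Icc_subset_Ici_self

theorem IsNhdIn.disjoint_closure_diff (h : IsNhdIn S A U) : Disjoint (closure (S \ U)) A := by
  refine disjoint_left.2 fun a ha haA => ?_
  obtain ⟨V, hV, hVU⟩ := mem_nhdsWithin_iff_exists_mem_nhds_inter.1 (h.2 a haA)
  obtain ⟨b, hbV, hbS, hbU⟩ := mem_closure_iff_nhds.1 ha V hV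
  exact hbU (hVU ⟨hbV, hbS⟩)

end Invariant

/-- `S` is a compact invariant set of the multiflow of `x' ∈ F(x, l)` over the compact space
`X`. -/
structure IsCompactInvariant (F : EuclideanSpace ℝ (Fin n) × ℝ → Set (EuclideanSpace ℝ (Fin n)))
    (l : ℝ) (X S : Set (EuclideanSpace ℝ (Fin n))) : Prop where
  compactSpace : IsCompact X
  filippov : FilippovOn F (X ×ˢ Icc (-1 : ℝ) 1)
  mem : l ∈ Icc (-1 : ℝ) 1
  subset : S ⊆ X
  closed : IsClosed S
  invariant : IsInvariant (perturbed F l) S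

/-! ### Attractor–repeller theory at a fixed parameter -/

section CompactInvariant

variable {F : EuclideanSpace ℝ (Fin n) × ℝ → Set (EuclideanSpace ℝ (Fin n))} {l : ℝ}
  {X S A U W : Set (EuclideanSpace ℝ (Fin n))}

theorem exists_bound_perturbed (hX : IsCompact X) (hF : FilippovOn F (X ×ˢ Icc (-1 : ℝ) 1)) :
    ∃ M : ℝ≥0, ∀ l ∈ Icc (-1 : ℝ) 1, ∀ p ∈ X, ∀ v ∈ perturbed F l p, ‖v‖ ≤ M := by
  obtain ⟨M, hM⟩ := hF.exists_bound (hX.prod isCompact_Icc)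
  exact ⟨M, fun l hl p hp v hv => hM (p, l) ⟨hp, hl⟩ v hv⟩

namespace IsCompactInvariant

theorem isCompact (h : IsCompactInvariant F l X S) : IsCompact S :=
  h.compactSpace.of_isClosed_subset h.closed h.subset

theorem exists_bound (h : IsCompactInvariant F l X S) :
    ∃ M : ℝ≥0, ∀ p ∈ S, ∀ v ∈ perturbed F l p, ‖v‖ ≤ M := by
  obtain ⟨M, hM⟩ := exists_bound_perturbed h.compactSpace h.filippov
  exact ⟨M, fun p hp => hM l h.mem p (h.subset hp)⟩

/-- Compactness of the orbits in a compact invariant set. -/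
theorem exists_tendsto (h : IsCompactInvariant F l X S) {ι : Type*} {𝓤 : Ultrafilter ι}
    {x : ι → ℝ → EuclideanSpace ℝ (Fin n)} {J : ι → Set ℝ} {I : Set ℝ} (hI : I.OrdConnected)
    (hx : ∀ k, IsOrbit (perturbed F l) S (J k) (x k))
    (hJ : ∀ a ∈ I, ∀ b ∈ I, ∀ᶠ k in 𝓤, Icc a b ⊆ J k) :
    ∃ y, IsOrbit (perturbed F l) S I y ∧ ∀ t ∈ I, Tendsto (fun k => x k t) 𝓤 (𝓝 (y t)) := by
  obtain ⟨y, hy, hlim⟩ := exists_isOrbit_tendsto (lam := fun _ => l) h.compactSpace h.filippov hI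
    (fun _ => h.mem) tendsto_const_nhds (fun k => (hx k).mono_space h.subset) hJ
  refine ⟨y, hy.mono Subset.rfl fun t ht => h.closed.mem_of_tendsto (hlim t ht) ?_, hlim⟩
  exact (hJ t ht t ht).mono fun k hk => (hx k).mapsTo t (hk ⟨le_rfl, le_rfl⟩)

/-- Orbits that approach `y` at times `t k → ∞` are extended forward and shifted by `t k`. Their
domains `[-t k, ∞)` exhaust `ℝ`, so the limit is a full orbit, and each of its points is a limit of
points reached from `U` after long times. -/
theorem isInvariant_omegaLim (h : IsCompactInvariant F l X S) :
    IsInvariant (perturbed F l) (omegaLim (perturbed F l) S U) := by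
  intro y hy
  obtain ⟨M, hM⟩ := h.exists_bound
  obtain ⟨x, t, ht, hx, hU, hlim⟩ := exists_seq_of_mem_omegaLim hy
  have ht0 : ∀ k, 0 ≤ t k := fun k => k.cast_nonneg.trans (ht k)
  choose z hz hzx using fun k => h.invariant.exists_extension hM (ht0 k) (hx k)
  have htop : Tendsto t (hyperfilter ℕ) atTop :=
    (tendsto_atTop_mono ht tendsto_natCast_atTop_atTop).mono_left Nat.hyperfilter_le_atTop
  obtain ⟨w, hw, hwlim⟩ := h.exists_tendsto (𝓤 := hyperfilter ℕ) ordConnected_univ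
    (fun k => (hz k).shift ordConnected_Ici hM (t k)) fun a _ b _ => by
      filter_upwards [htop.eventually_ge_atTop (-a)] with k hk s hs
      change 0 ≤ s + t k
      linarith [hs.1]
  refine ⟨w, hw.mono Subset.rfl fun s _ => ?_, ?_⟩
  · refine mem_omegaLim_of_tendsto (a := fun k => z k 0) (t := fun k => s + t k)
      (tendsto_atTop_add_const_left _ s htop) (Eventually.of_forall fun k => ?_) ?_
      (hwlim s trivial)
    · rw [hzx k ⟨le_rfl, ht0 k⟩]
      exact hU k
    · filter_upwards [htop.eventually_ge_atTop (-s)] with k hk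
      have := (hz k).mem_multiflow hM (s := 0) (t := s + t k) (by linarith) Icc_subset_Ici_self
      rwa [sub_zero] at this
  · refine tendsto_nhds_unique (hwlim 0 trivial) ?_
    refine (hlim.mono_left Nat.hyperfilter_le_atTop).congr fun k => ?_
    rw [zero_add, hzx k ⟨ht0 k, le_rfl⟩]

/-- Orbits of growing length avoid `U` except possibly during their last `T` units of time; at any
fixed time that exception eventually disappears, so the limit orbit stays in `closure (S \ U)`. -/
theorem exists_orbit_closure_diff (h : IsCompactInvariant F l X S)
    {x : ℕ → ℝ → EuclideanSpace ℝ (Fin n)} {t : ℕ → ℝ} {T : ℝ} {y : EuclideanSpace ℝ (Fin n)}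
    (ht : ∀ k : ℕ, (k : ℝ) ≤ t k) (hx : ∀ k, IsOrbit (perturbed F l) S (Icc 0 (t k)) (x k))
    (hy : Tendsto (fun k => x k 0) atTop (𝓝 y))
    (hU : ∀ᶠ k in atTop, ∀ s ∈ Icc 0 (t k), s + T ≤ t k → x k s ∉ U) :
    ∃ z, IsOrbit (perturbed F l) S (Ici 0) z ∧ z 0 = y ∧ ∀ s ≥ 0, z s ∈ closure (S \ U) := by
  have hle := Nat.hyperfilter_le_atTop
  have htop : Tendsto t (hyperfilter ℕ) atTop :=
    (tendsto_atTop_mono ht tendsto_natCast_atTop_atTop).mono_left hle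
  obtain ⟨z, hz, hlim⟩ := h.exists_tendsto (𝓤 := hyperfilter ℕ) (ordConnected_Ici (a := (0 : ℝ)))
    hx fun a (ha : 0 ≤ a) b _ => by
      filter_upwards [htop.eventually_ge_atTop b] with k hk
      exact Icc_subset_Icc ha hk
  refine ⟨z, hz, tendsto_nhds_unique (hlim 0 (mem_Ici.2 le_rfl)) (hy.mono_left hle), fun s hs => ?_⟩
  refine mem_closure_of_tendsto (hlim s hs) ?_
  filter_upwards [htop.eventually_ge_atTop s, htop.eventually_ge_atTop (s + T), hle hU]
    with k h1 h2 h3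
  exact ⟨(hx k).mapsTo s ⟨hs, h1⟩, h3 s ⟨hs, h1⟩ h2⟩

/-- From each point of the dual repeller of `ω_S(U)` starts an orbit that never enters the interior
of `U`. -/
theorem exists_orbit_of_mem_dualRepeller (h : IsCompactInvariant F l X S)
    (hA : omegaLim (perturbed F l) S U = A) {a : EuclideanSpace ℝ (Fin n)}
    (ha : a ∈ dualRepeller (perturbed F l) S A) :
    ∃ z, IsOrbit (perturbed F l) S (Ici 0) z ∧ z 0 = a ∧ ∀ s ≥ 0, z s ∈ closure (S \ U) := by
  obtain ⟨M, hM⟩ := h.exists_bound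
  obtain ⟨y, hy, hyA⟩ := not_subset.1 ha.2
  obtain ⟨x, t, ht, hx, hx0, hlim⟩ := exists_seq_of_mem_omegaLim hy
  rw [← hA] at hyA
  simp only [omegaLim, mem_iInter, not_forall] at hyA
  -- The point `y` is away from everything reached from `U` after time `T`. An orbit ending near `y`
  -- therefore cannot visit `U` with at least `T` time left.
  obtain ⟨T, hT, hyT⟩ := hyA
  refine h.exists_orbit_closure_diff (T := T) ht hx ?_ ?_
  · exact tendsto_const_nhds.congr fun k => (hx0 k).symm
  · filter_upwards [hlim.eventually (isClosed_closure.isOpen_compl.mem_nhds hyT)] with k hk s hs hsT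
      hsU
    refine hk (subset_closure (mem_iUnion₂.2 ⟨t k - s, ?_, mem_iUnion₂.2 ⟨x k s, hsU, ?_⟩⟩))
    · exact mem_Ici.2 (by linarith)
    · exact (hx k).mem_multiflow hM hs.2 (Icc_subset_Icc_left hs.1)

theorem dualRepeller_subset (h : IsCompactInvariant F l X S)
    (hA : omegaLim (perturbed F l) S U = A) :
    dualRepeller (perturbed F l) S A ⊆ closure (S \ U) := fun a ha => by
  obtain ⟨z, -, rfl, hz⟩ := h.exists_orbit_of_mem_dualRepeller hA ha
  exact hz 0 le_rfl

/-- The forward orbit avoiding `U` is preceded by any backward orbit in `S`. From every point of the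
concatenation the future ends up in `closure (S \ U)`, away from `A`, so the whole orbit lies in the
dual repeller. -/
theorem isInvariant_dualRepeller (h : IsCompactInvariant F l X S) (hU : IsNhdIn S A U)
    (hA : omegaLim (perturbed F l) S U = A) :
    IsInvariant (perturbed F l) (dualRepeller (perturbed F l) S A) := by
  obtain ⟨M, hM⟩ := h.exists_bound
  intro a ha
  obtain ⟨z, hz, hz0, hzU⟩ := h.exists_orbit_of_mem_dualRepeller hA ha
  obtain ⟨w, hw, hw0⟩ := h.invariant a ha.1
  have hcat : IsOrbit (perturbed F l) S univ fun t => if t ≤ 0 then w t else z t :=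
    IsOrbit.concat ordConnected_univ hM (mem_univ 0) (hw.mono_time (subset_univ _))
      (hz.mono_time fun t ht => ht.2) (hw0.trans hz0.symm)
  refine ⟨_, hcat.mono Subset.rfl fun s _ => ?_, by simpa using hw0⟩
  have := mem_dualRepeller_of_eventually_mem hM h.isCompact isClosed_closure
    hU.disjoint_closure_diff (hcat.shift_Ici hM ordConnected_univ (c := s) (subset_univ _)) (by
      filter_upwards [eventually_gt_atTop (-s)] with t ht
      rw [if_neg (by linarith)]
      exact hzU _ (by linarith))
  simpa only [zero_add] using this

/-- Orbits from `U` leave `W` for good after some time `T`. Hence long orbits ending in `W` avoid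
`U` until their last `T` units, and a limit of their starting points starts an orbit avoiding the
interior of `U`. Conversely, full orbits in the dual repeller lie in `W`. -/
theorem alphaLim_eq_dualRepeller (h : IsCompactInvariant F l X S) (hU : IsNhdIn S A U)
    (hA : omegaLim (perturbed F l) S U = A) (hW : IsClosed W) (hWA : Disjoint W A)
    (hRW : dualRepeller (perturbed F l) S A ⊆ W) :
    alphaLim (perturbed F l) S W = dualRepeller (perturbed F l) S A := by
  obtain ⟨M, hM⟩ := h.exists_bound
  refine Subset.antisymm (fun y hy => ?_) fun a ha => ?_
  · obtain ⟨T, hT, hTW⟩ := exists_time_multiflow_subset h.isCompact hW.isOpen_compl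
      (hA.trans_subset hWA.subset_compl_left)
    have key : ∀ k : ℕ, ∃ (x : ℝ → EuclideanSpace ℝ (Fin n)) (t : ℝ), (k : ℝ) ≤ t ∧
        IsOrbit (perturbed F l) S (Icc 0 t) x ∧ x t ∈ W ∧ dist (x 0) y < 1 / ((k : ℝ) + 1) := by
      intro k
      have hk := mem_iInter₂.1 hy (-((k : ℝ) + 1))
        (by rw [mem_Iio]; linarith [k.cast_nonneg (α := ℝ)])
      obtain ⟨b, hb, hd⟩ := Metric.mem_closure_iff.1 hk _ (Nat.one_div_pos_of_nat (n := k))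
      simp only [mem_iUnion] at hb
      obtain ⟨t, ht, a, ha, -, -, x, hx, rfl, rfl⟩ := hb
      exact ⟨x, -t, by linarith [mem_Iic.1 ht], hx, ha, by rwa [dist_comm]⟩
    choose x t h1 h2 h3 h4 using key
    obtain ⟨z, hz, rfl, hzU⟩ := h.exists_orbit_closure_diff (T := T) (U := U) h1 h2
      (tendsto_iff_dist_tendsto_zero.2 <| squeeze_zero (fun _ => dist_nonneg)
        (fun k => (h4 k).le) tendsto_one_div_add_atTop_nhds_zero_nat) (by
      filter_upwards with k s hs hsT hsU
      exact hTW (t k - s) (by linarith) _ hsU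
        ((h2 k).mem_multiflow hM hs.2 (Icc_subset_Icc_left hs.1)) (h3 k))
    exact mem_dualRepeller_of_eventually_mem hM h.isCompact isClosed_closure
      hU.disjoint_closure_diff hz ((eventually_ge_atTop 0).mono hzU)
  · obtain ⟨x, hx, rfl⟩ := h.isInvariant_dualRepeller hU hA a ha
    simp only [alphaLim, mem_iInter]
    intro t ht
    refine subset_closure (mem_iUnion₂.2 ⟨t, mem_Iic.2 le_rfl, mem_iUnion₂.2 ⟨x (-t),
      hRW (hx.mapsTo _ trivial), ha.1, ?_⟩⟩)
    have := (hx.mono_space fun _ h => h.1).mem_multiflow hM (s := 0) (t := -t)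
      (by linarith [mem_Iio.1 ht]) (subset_univ _)
    rwa [sub_zero] at this

end IsCompactInvariant

end CompactInvariant

/-! ### Stability under change of the parameter -/

section Perturbation

variable {F : EuclideanSpace ℝ (Fin n) × ℝ → Set (EuclideanSpace ℝ (Fin n))} {l : ℝ}
  {X N S A B O U W : Set (EuclideanSpace ℝ (Fin n))}

/-- `Inv(N, Φ_l)` depends upper semicontinuously on `l`. -/
theorem mem_inv_of_tendsto (hX : IsCompact X) (hF : FilippovOn F (X ×ˢ Icc (-1 : ℝ) 1))
    (hN : IsClosed N) (hNX : N ⊆ X) {ι : Type*} {𝓤 : Ultrafilter ι} {lam : ι → ℝ}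
    (hlam : ∀ k, lam k ∈ Icc (-1 : ℝ) 1) (hl : Tendsto lam 𝓤 (𝓝 l))
    {a : ι → EuclideanSpace ℝ (Fin n)} {b : EuclideanSpace ℝ (Fin n)}
    (ha : ∀ k, a k ∈ Inv (perturbed F (lam k)) N) (hab : Tendsto a 𝓤 (𝓝 b)) :
    b ∈ Inv (perturbed F l) N := by
  choose haN x hx hx0 using ha
  obtain ⟨y, hy, hlim⟩ := exists_isOrbit_tendsto (I := univ) (J := fun _ => univ) hX hF
    ordConnected_univ hlam hl (fun k => (hx k).mono_space hNX)
    fun _ _ _ _ => Eventually.of_forall fun _ => subset_univ _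
  have hyN : ∀ t, y t ∈ N := fun t => hN.mem_of_tendsto (hlim t trivial)
    (Eventually.of_forall fun k => (hx k).mapsTo t trivial)
  have h0 : y 0 = b := tendsto_nhds_unique (hlim 0 trivial) (hab.congr fun k => (hx0 k).symm)
  exact ⟨h0 ▸ hyN 0, y, hy.mono Subset.rfl fun t _ => hyN t, h0⟩

theorem isCompactInvariant_inv (hX : IsCompact X) (hF : FilippovOn F (X ×ˢ Icc (-1 : ℝ) 1))
    (hN : IsClosed N) (hNX : N ⊆ X) (hl : l ∈ Icc (-1 : ℝ) 1) :
    IsCompactInvariant F l X (Inv (perturbed F l) N) where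
  compactSpace := hX
  filippov := hF
  mem := hl
  subset := fun a ha => hNX ha.1
  closed := by
    refine isClosed_of_closure_subset fun b hb => ?_
    obtain ⟨a, ha, hab⟩ := mem_closure_iff_seq_limit.1 hb
    exact mem_inv_of_tendsto hX hF hN hNX (𝓤 := hyperfilter ℕ) (fun _ => hl) tendsto_const_nhds ha
      (hab.mono_left Nat.hyperfilter_le_atTop)
  invariant := by
    obtain ⟨M, hM⟩ := exists_bound_perturbed hX hF
    exact isInvariant_inv fun p hp => hM l hl p (hNX hp)

theorem eventually_nhdsWithin_of_forall_seq {P : ℝ → Prop} {D : Set ℝ}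
    (h : ∀ lam : ℕ → ℝ, (∀ k, lam k ∈ D) → Tendsto lam (hyperfilter ℕ) (𝓝 l) →
      ¬ ∀ k, ¬ P (lam k)) : ∀ᶠ m in 𝓝[D] l, P m := by
  by_contra hcon
  obtain ⟨lam, hlim, hlam⟩ := exists_seq_forall_of_frequently
    ((not_eventually.1 hcon).and_eventually self_mem_nhdsWithin)
  exact h lam (fun k => (hlam k).2)
    ((hlim.mono_right nhdsWithin_le_nhds).mono_left Nat.hyperfilter_le_atTop) fun k => (hlam k).1

theorem eventually_isIsolatingNhd (hX : IsCompact X) (hF : FilippovOn F (X ×ˢ Icc (-1 : ℝ) 1))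
    (hN : IsIsolatingNhd (perturbed F l) X N) :
    ∀ᶠ m in 𝓝[Icc (-1) 1] l, IsIsolatingNhd (perturbed F m) X N := by
  refine eventually_nhdsWithin_of_forall_seq fun lam hlam hl hcon => ?_
  have key : ∀ k, ∃ a ∈ Inv (perturbed F (lam k)) N, N ∉ 𝓝[X] a := fun k => by
    by_contra! h
    exact hcon k ⟨hN.subset, hN.compact, h⟩
  choose a ha haN using key
  obtain ⟨b, -, hb⟩ := hN.compact.ultrafilter_le_nhds ((hyperfilter ℕ).map a) (by
    rw [le_principal_iff]
    exact mem_map.2 (Eventually.of_forall fun k : ℕ => (ha k).1))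
  have hab : Tendsto a (hyperfilter ℕ) (𝓝 b) := hb
  have hbN := hN.inv_subset_interior b
    (mem_inv_of_tendsto hX hF hN.compact.isClosed hN.subset hlam hl ha hab)
  have habX : Tendsto a (hyperfilter ℕ) (𝓝[X] b) := tendsto_nhdsWithin_iff.2
    ⟨hab, Eventually.of_forall fun k => hN.subset (ha k).1⟩
  obtain ⟨k, hk⟩ := (habX.eventually (eventually_eventually_nhdsWithin.2 hbN)).exists
  exact haN k hk

/-- Cutting off initial pieces of length `T` reduces any longer time to one in `[T, 2T]`. This makes
the unbounded condition accessible to compactness. -/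
theorem multiflow_subset_of_forall_Icc
    {G : EuclideanSpace ℝ (Fin n) → Set (EuclideanSpace ℝ (Fin n))}
    {M : ℝ≥0} {T : ℝ} (hM : ∀ p ∈ S, ∀ v ∈ G p, ‖v‖ ≤ M) (hT : 0 < T)
    (h : ∀ t ∈ Icc T (2 * T), ∀ a ∈ B, multiflow G S t a ⊆ B) :
    ∀ t ≥ T, ∀ a ∈ B, multiflow G S t a ⊆ B := by
  have key : ∀ k : ℕ, ∀ t ≥ T, t ≤ (k + 2) * T → ∀ a ∈ B, multiflow G S t a ⊆ B := by
    intro k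
    induction k with
    | zero => exact fun t h1 h2 => h t ⟨h1, by simpa using h2⟩
    | succ k ih =>
      intro t h1 h2 a ha
      by_cases h3 : t ≤ 2 * T
      · exact h t ⟨h1, h3⟩ a ha
      rintro _ ⟨-, x, hx, rfl, rfl⟩
      have hTB : x T ∈ B := h T ⟨le_rfl, by linarith⟩ _ ha (by
        simpa using hx.mem_multiflow hM hT.le (Icc_subset_Icc_right h1))
      push_cast at h2
      exact ih (t - T) (by linarith) (by linarith) _ hTB
        (hx.mem_multiflow hM h1 (Icc_subset_Icc_left hT.le))
  intro t ht
  obtain ⟨k, hk⟩ := exists_nat_ge (t / T)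
  refine key k t ht ?_
  rw [div_le_iff₀ hT] at hk
  linarith

/-- Absorption after a finite time is stable under perturbations. -/
theorem eventually_multiflow_subset (hX : IsCompact X)
    (hF : FilippovOn F (X ×ˢ Icc (-1 : ℝ) 1)) (hN : IsClosed N) (hNX : N ⊆ X)
    (hB : IsClosed B) {T : ℝ} (hT : 0 < T)
    (hO : ∀ t ≥ T, ∀ a ∈ B ∩ Inv (perturbed F l) N,
      multiflow (perturbed F l) (Inv (perturbed F l) N) t a ⊆ O)
    (hOB : ∀ p ∈ O ∩ Inv (perturbed F l) N, B ∈ 𝓝[X] p) :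
    ∀ᶠ m in 𝓝[Icc (-1) 1] l, ∀ t ≥ T, ∀ a ∈ B,
      multiflow (perturbed F m) (Inv (perturbed F m) N) t a ⊆ B := by
  obtain ⟨M, hM⟩ := exists_bound_perturbed hX hF
  suffices h : ∀ᶠ m in 𝓝[Icc (-1) 1] l, ∀ t ∈ Icc T (2 * T), ∀ a ∈ B,
      multiflow (perturbed F m) (Inv (perturbed F m) N) t a ⊆ B by
    filter_upwards [h, self_mem_nhdsWithin] with m hm hmI
    exact multiflow_subset_of_forall_Icc (fun p hp => hM m hmI p (hNX hp.1)) hT hm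
  refine eventually_nhdsWithin_of_forall_seq fun lam hlam hl hcon => ?_
  have key : ∀ k, ∃ t ∈ Icc T (2 * T), ∃ x,
      IsOrbit (perturbed F (lam k)) (Inv (perturbed F (lam k)) N) (Ici 0) x ∧
        x 0 ∈ B ∧ x t ∉ B := fun k => by
    have := hcon k
    push Not at this
    obtain ⟨t, ht, a, ha, hsub⟩ := this
    obtain ⟨_, ⟨ht0, x, hx, rfl, rfl⟩, hxt⟩ := not_subset.1 hsub
    obtain ⟨z, hz, hzx⟩ := (isCompactInvariant_inv hX hF hN hNX
      (hlam k)).invariant.exists_extension (fun p hp => hM _ (hlam k) p (hNX hp.1)) ht0 hx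
    refine ⟨t, ht, z, hz, ?_, ?_⟩
    · rwa [hzx ⟨le_rfl, ht0⟩]
    · rwa [hzx ⟨ht0, le_rfl⟩]
  choose t ht x hx hx0 hxt using key
  obtain ⟨y, hy, hlim⟩ := exists_isOrbit_tendsto (𝓤 := hyperfilter ℕ) hX hF
    (ordConnected_Ici (a := (0 : ℝ))) hlam hl
    (fun k => (hx k).mono_space fun p hp => hNX hp.1)
    fun a (ha : 0 ≤ a) b _ => Eventually.of_forall fun _ =>
      Icc_subset_Ici_self.trans (Ici_subset_Ici.2 ha)
  have hyS : ∀ s ∈ Ici (0 : ℝ), y s ∈ Inv (perturbed F l) N := fun s hs =>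
    mem_inv_of_tendsto hX hF hN hNX hlam hl (fun k => (hx k).mapsTo s hs) (hlim s hs)
  obtain ⟨r, hr, hr'⟩ := isCompact_Icc.ultrafilter_le_nhds ((hyperfilter ℕ).map t) (by
    rw [le_principal_iff]
    exact mem_map.2 (Eventually.of_forall fun k : ℕ => ht k))
  have htr : Tendsto t (hyperfilter ℕ) (𝓝 r) := hr'
  have hr0 : 0 ≤ r := hT.le.trans hr.1
  -- The common Lipschitz constant lets the evaluation times vary: `x k (t k)` is close to `x k r`,
  -- which tends to `y r`.
  have hxr : Tendsto (fun k => x k (t k)) (hyperfilter ℕ) (𝓝 (y r)) := by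
    rw [tendsto_iff_dist_tendsto_zero]
    have h1 := ((tendsto_iff_dist_tendsto_zero.1 htr).const_mul (M : ℝ)).add
      (tendsto_iff_dist_tendsto_zero.1 (hlim r hr0))
    rw [mul_zero, add_zero] at h1
    refine squeeze_zero (fun _ => dist_nonneg) (fun k => ?_) h1
    refine (dist_triangle _ (x k r) _).trans (add_le_add ?_ le_rfl)
    exact ((isOrbit_iff ordConnected_Ici fun p hp => hM _ (hlam k) p (hNX hp.1)).1
      (hx k)).1.dist_le_mul _ (hT.le.trans (ht k).1) _ hr0
  have hl1 : l ∈ Icc (-1 : ℝ) 1 := isClosed_Icc.mem_of_tendsto hl (Eventually.of_forall hlam)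
  have hy0 : y 0 ∈ B := hB.mem_of_tendsto (hlim 0 (mem_Ici.2 le_rfl)) (Eventually.of_forall hx0)
  have hyO : y r ∈ O := hO r hr.1 _ ⟨hy0, hyS 0 (mem_Ici.2 le_rfl)⟩ (by
    simpa using (hy.mono Subset.rfl hyS).mem_multiflow (fun p hp => hM l hl1 p (hNX hp.1)) hr0
      Icc_subset_Ici_self)
  have hxX : Tendsto (fun k => x k (t k)) (hyperfilter ℕ) (𝓝[X] (y r)) := tendsto_nhdsWithin_iff.2
    ⟨hxr, Eventually.of_forall fun k => hNX ((hx k).mapsTo _ (hT.le.trans (ht k).1)).1⟩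
  obtain ⟨k, hk⟩ := (hxX.eventually (hOB _ ⟨hyO, hyS r hr0⟩)).exists
  exact hxt k hk

/-- If every forward orbit in `Inv(N, Φ_l)` that avoids the interior of `B` starts in the interior
of `W`, then, for nearby parameter values `m`, every forward orbit in `Inv(N, Φ_m)` that stays in
the closure of the complement of `B` starts in `W`. -/
theorem eventually_forward_orbit_mem (hX : IsCompact X)
    (hF : FilippovOn F (X ×ˢ Icc (-1 : ℝ) 1)) (hN : IsClosed N) (hNX : N ⊆ X)
    (h : ∀ z, IsOrbit (perturbed F l) (Inv (perturbed F l) N) (Ici 0) z →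
      (∀ t ≥ 0, B ∉ 𝓝[X] (z t)) → W ∈ 𝓝[X] (z 0)) :
    ∀ᶠ m in 𝓝[Icc (-1) 1] l, ∀ z,
      IsOrbit (perturbed F m) (Inv (perturbed F m) N) (Ici 0) z →
        (∀ t ≥ 0, z t ∈ closure (Inv (perturbed F m) N \ B)) → z 0 ∈ W := by
  refine eventually_nhdsWithin_of_forall_seq fun lam hlam hl hcon => ?_
  push Not at hcon
  choose x hx hxB hxW using hcon
  obtain ⟨y, hy, hlim⟩ := exists_isOrbit_tendsto (𝓤 := hyperfilter ℕ) hX hF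
    (ordConnected_Ici (a := (0 : ℝ))) hlam hl
    (fun k => (hx k).mono_space fun p hp => hNX hp.1)
    fun a (ha : 0 ≤ a) b _ => Eventually.of_forall fun _ =>
      Icc_subset_Ici_self.trans (Ici_subset_Ici.2 ha)
  have hyS : ∀ s ∈ Ici (0 : ℝ), y s ∈ Inv (perturbed F l) N := fun s hs =>
    mem_inv_of_tendsto hX hF hN hNX hlam hl (fun k => (hx k).mapsTo s hs) (hlim s hs)
  have htend : ∀ s ∈ Ici (0 : ℝ), Tendsto (fun k => x k s) (hyperfilter ℕ) (𝓝[X] (y s)) :=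
    fun s hs => tendsto_nhdsWithin_iff.2
      ⟨hlim s hs, Eventually.of_forall fun k => hNX ((hx k).mapsTo s hs).1⟩
  have hW := h y (hy.mono Subset.rfl hyS) fun t ht hB => by
    obtain ⟨k, hk⟩ := ((htend t ht).eventually (eventually_eventually_nhdsWithin.2 hB)).exists
    obtain ⟨V, hV, hVB⟩ := mem_nhdsWithin_iff_exists_mem_nhds_inter.1 hk
    obtain ⟨b, hbV, hbS, hbB⟩ := mem_closure_iff_nhds.1 (hxB k t ht) V hV
    exact hbB (hVB ⟨hbV, hNX hbS.1⟩)
  obtain ⟨k, hk⟩ := ((htend 0 (mem_Ici.2 le_rfl)).eventually hW).exists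
  exact hxW k hk

end Perturbation

/-! ### Assembling the pair at nearby parameters -/

section Continuation

variable {F : EuclideanSpace ℝ (Fin n) × ℝ → Set (EuclideanSpace ℝ (Fin n))} {l : ℝ}
  {X N S A B U W : Set (EuclideanSpace ℝ (Fin n))}

theorem inter_mem_nhdsWithin_of_mem_thickening {p : EuclideanSpace ℝ (Fin n)} {δ : ℝ}
    (hN : N ∈ 𝓝[X] p) (hp : p ∈ Metric.thickening δ A) :
    N ∩ Metric.cthickening δ A ∈ 𝓝[X] p :=
  inter_mem hN (mem_nhdsWithin_of_mem_nhds (mem_of_superset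
    (Metric.isOpen_thickening.mem_nhds hp) (Metric.thickening_subset_cthickening δ A)))

theorem IsCompactInvariant.isAttractorRepellerPair_and_isRepeller
    (h : IsCompactInvariant F l X (Inv (perturbed F l) N))
    (hB : IsIsolatingNhd (perturbed F l) X B) (hW : IsIsolatingNhd (perturbed F l) X W)
    (hBN : B ⊆ N) (hWN : W ⊆ N) (hWB : Disjoint W B)
    {T : ℝ} (hT : ∀ t ≥ T, ∀ a ∈ B,
      multiflow (perturbed F l) (Inv (perturbed F l) N) t a ⊆ B)
    (hfwd : ∀ z, IsOrbit (perturbed F l) (Inv (perturbed F l) N) (Ici 0) z →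
        (∀ t ≥ 0, z t ∈ closure (Inv (perturbed F l) N \ B)) → z 0 ∈ W) :
    IsAttractorRepellerPair (perturbed F l) (Inv (perturbed F l) N) (Inv (perturbed F l) B)
      (Inv (perturbed F l) W) ∧
    IsRepeller (perturbed F l) (Inv (perturbed F l) N) (Inv (perturbed F l) W) := by
  obtain ⟨M, hM⟩ := exists_bound_perturbed h.compactSpace h.filippov
  have hMX := hM l h.mem
  have hMS := fun p hp => hMX p (h.subset hp)
  have hIB := isInvariant_inv fun p hp => hMX p (hB.subset hp)
  have hIW := isInvariant_inv fun p hp => hMX p (hW.subset hp)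
  set S := Inv (perturbed F l) N with hS
  have hnhd : ∀ {V}, IsIsolatingNhd (perturbed F l) X V →
      IsNhdIn S (Inv (perturbed F l) V) (V ∩ S) :=
    fun hV => ⟨inter_subset_right, fun a ha => inter_mem
      (nhdsWithin_mono _ h.subset (hV.inv_subset_interior a ha)) self_mem_nhdsWithin⟩
  have homega : omegaLim (perturbed F l) S (B ∩ S) = Inv (perturbed F l) B := by
    refine Subset.antisymm (h.isInvariant_omegaLim.subset_inv fun y hy => ?_)
      (hIB.subset_omegaLim hMS (Inv_mono hBN) fun a ha => ⟨ha.1, Inv_mono hBN ha⟩)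
    -- The cut-off `max T 0` is needed because `omegaLim` only intersects over nonnegative times and
    -- `T` carries no sign.
    refine hB.compact.isClosed.closure_subset_iff.2 ?_
      (mem_iInter₂.1 hy (max T 0) (mem_Ici.2 (le_max_right _ _)))
    exact iUnion₂_subset fun t ht => iUnion₂_subset fun a ha =>
      hT t ((le_max_left _ _).trans ht) a ha.1
  have hsub : dualRepeller (perturbed F l) S (Inv (perturbed F l) B) ⊆ W := fun a ha => by
    obtain ⟨z, hz, rfl, hzB⟩ := h.exists_orbit_of_mem_dualRepeller homega ha
    refine hfwd z hz ?_
    rwa [inter_comm, sdiff_self_inter] at hzB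
  have hdual : Inv (perturbed F l) W =
      dualRepeller (perturbed F l) S (Inv (perturbed F l) B) := by
    refine Subset.antisymm (fun a ha => ?_)
      ((h.isInvariant_dualRepeller (hnhd hB) homega).subset_inv hsub)
    obtain ⟨x, hx, rfl⟩ := hIW a ha
    exact mem_dualRepeller_of_eventually_mem hMS h.isCompact hW.compact.isClosed
      (hWB.mono_right fun _ h => h.1) ((hx.mono_space (Inv_mono hWN)).mono_time (subset_univ _))
      (Eventually.of_forall fun t => (hx.mapsTo t trivial).1)
  refine ⟨⟨⟨Inv_mono hBN, _, hnhd hB, homega⟩, hdual⟩, Inv_mono hWN, W ∩ S, hnhd hW, ?_⟩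
  rw [hdual]
  refine h.alphaLim_eq_dualRepeller (hnhd hB) homega (hW.compact.isClosed.inter h.closed) ?_
    fun a ha => ⟨hsub ha, ha.1⟩
  exact hWB.mono inter_subset_left fun _ h => h.1

end Continuation

end DiffIncl

theorem mainTheorem2 {n : ℕ} (X : Set (EuclideanSpace ℝ (Fin n))) (hX : IsCompact X)
    (F : EuclideanSpace ℝ (Fin n) × ℝ → Set (EuclideanSpace ℝ (Fin n)))
    (hF : DiffIncl.FilippovOn F (X ×ˢ Set.Icc (-1 : ℝ) 1))
    (N : Set (EuclideanSpace ℝ (Fin n)))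
    (hN : DiffIncl.IsIsolatingNhd (DiffIncl.perturbed F 0) X N)
    (A₀ R₀ : Set (EuclideanSpace ℝ (Fin n)))
    (hAR : DiffIncl.IsAttractorRepellerPair (DiffIncl.perturbed F 0)
      (DiffIncl.Inv (DiffIncl.perturbed F 0) N) A₀ R₀) :
    ∃ N_A N_R : Set (EuclideanSpace ℝ (Fin n)),
      N_A ⊆ N ∧ N_R ⊆ N ∧
      DiffIncl.Inv (DiffIncl.perturbed F 0) N_A = A₀ ∧
      DiffIncl.Inv (DiffIncl.perturbed F 0) N_R = R₀ ∧
      ∃ ε > (0 : ℝ), ∀ l ∈ Set.Icc (-1 : ℝ) 1, |l| < ε →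
        DiffIncl.IsIsolatingNhd (DiffIncl.perturbed F l) X N ∧
        DiffIncl.IsIsolatingNhd (DiffIncl.perturbed F l) X N_A ∧
        DiffIncl.IsIsolatingNhd (DiffIncl.perturbed F l) X N_R ∧
        DiffIncl.IsAttractorRepellerPair (DiffIncl.perturbed F l)
          (DiffIncl.Inv (DiffIncl.perturbed F l) N)
          (DiffIncl.Inv (DiffIncl.perturbed F l) N_A)
          (DiffIncl.Inv (DiffIncl.perturbed F l) N_R) ∧
        DiffIncl.IsRepeller (DiffIncl.perturbed F l)
          (DiffIncl.Inv (DiffIncl.perturbed F l) N)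
          (DiffIncl.Inv (DiffIncl.perturbed F l) N_R) := by
  open DiffIncl Filter in
  obtain ⟨⟨hAS, U, hU, hω⟩, rfl⟩ := hAR
  have hNc := hN.compact.isClosed
  have h0 : (0 : ℝ) ∈ Icc (-1 : ℝ) 1 := by simp
  have h := isCompactInvariant_inv hX hF hNc hN.subset h0
  obtain ⟨M, hM⟩ := h.exists_bound
  obtain ⟨M', hMX⟩ := exists_bound_perturbed hX hF
  set S := Inv (perturbed F 0) N with hS
  set K := closure (S \ U) with hK
  have hKS : K ⊆ S := h.closed.closure_subset_iff.2 sdiff_subset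
  have hKc : IsCompact K := h.isCompact.of_isClosed_subset isClosed_closure hKS
  have hAc : IsClosed A₀ := hω ▸ isClosed_omegaLim
  -- Both sets are closed and `K` is compact, so they have disjoint closed `δ`-neighbourhoods; these
  -- yield `N_R` and `N_A`.
  obtain ⟨δ, hδ, hdisj⟩ := hU.disjoint_closure_diff.exists_cthickenings hKc hAc
  have hinv : ∀ C, IsInvariant (perturbed F 0) (Inv (perturbed F 0) (N ∩ C)) := fun C =>
    isInvariant_inv fun p hp => hMX 0 h0 p (hN.subset hp.1)
  have hUδ : Metric.cthickening δ A₀ ∩ S ⊆ U := fun p hp => by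
    by_contra hpU
    exact disjoint_left.1 hdisj (Metric.self_subset_cthickening _ (subset_closure ⟨hp.2, hpU⟩)) hp.1
  have hωinv : IsInvariant (perturbed F 0) A₀ := hω ▸ h.isInvariant_omegaLim
  have hNA : Inv (perturbed F 0) (N ∩ Metric.cthickening δ A₀) = A₀ := by
    refine Subset.antisymm (fun a ha => ?_)
      (hωinv.subset_inv fun a ha => ⟨(hAS ha).1, Metric.self_subset_cthickening _ ha⟩)
    rw [← hω]
    exact (hinv _).subset_omegaLim hM (Inv_mono inter_subset_left)
      (fun p hp => hUδ ⟨hp.1.2, Inv_mono inter_subset_left hp⟩) ha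
  -- `K` may exceed the dual repeller, but a full orbit in its `δ`-neighbourhood cannot accumulate
  -- on `A₀`, so the invariant part is no larger.
  have hNR : Inv (perturbed F 0) (N ∩ Metric.cthickening δ K) =
      dualRepeller (perturbed F 0) S A₀ := by
    refine Subset.antisymm (fun a ha => ?_)
      ((h.isInvariant_dualRepeller hU hω).subset_inv fun a ha =>
        ⟨ha.1.1, Metric.self_subset_cthickening _ (h.dualRepeller_subset hω ha)⟩)
    obtain ⟨x, hx, rfl⟩ := hinv _ a ha
    exact mem_dualRepeller_of_eventually_mem hM h.isCompact Metric.isClosed_cthickening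
      (hdisj.mono_right (Metric.self_subset_cthickening _)) 
      ((hx.mono_space (Inv_mono inter_subset_left)).mono_time (subset_univ _))
      (Eventually.of_forall fun t => (hx.mapsTo t trivial).1.2)
  have hisoA : IsIsolatingNhd (perturbed F 0) X (N ∩ Metric.cthickening δ A₀) := by
    refine ⟨inter_subset_left.trans hN.subset, hN.compact.inter_right Metric.isClosed_cthickening,
      fun a ha => ?_⟩
    exact inter_mem_nhdsWithin_of_mem_thickening
      (hN.inv_subset_interior a (Inv_mono inter_subset_left ha))
      (Metric.self_subset_thickening hδ _ (hNA.subset ha))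
  have hisoR : IsIsolatingNhd (perturbed F 0) X (N ∩ Metric.cthickening δ K) := by
    refine ⟨inter_subset_left.trans hN.subset, hN.compact.inter_right Metric.isClosed_cthickening,
      fun a ha => ?_⟩
    exact inter_mem_nhdsWithin_of_mem_thickening
      (hN.inv_subset_interior a (Inv_mono inter_subset_left ha))
      (Metric.self_subset_thickening hδ _ (h.dualRepeller_subset hω (hNR.subset ha)))
  obtain ⟨T, hT, hTO⟩ := exists_time_multiflow_subset h.isCompact Metric.isOpen_thickening
    (hω.trans_subset (Metric.self_subset_thickening hδ A₀))
  have hflow := eventually_multiflow_subset (O := Metric.thickening δ A₀) hX hF hNc hN.subset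
    hisoA.compact.isClosed hT (fun t ht a ha => hTO t ht a (hUδ ⟨ha.1.2, ha.2⟩))
    fun p hp => inter_mem_nhdsWithin_of_mem_thickening (hN.inv_subset_interior p hp.2) hp.1
  have hfwd := eventually_forward_orbit_mem (l := 0) (B := N ∩ Metric.cthickening δ A₀)
    (W := N ∩ Metric.cthickening δ K) hX hF hNc hN.subset fun z hz hzB =>
      hisoR.inv_subset_interior _ (by
        rw [hNR]
        -- Points of `S` in the open `δ`-neighbourhood of `A₀` are interior to `N_A`, so `z` stays
        -- in the closed complement of that neighbourhood, which misses `A₀`.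
        refine mem_dualRepeller_of_eventually_mem hM h.isCompact
          (Metric.isOpen_thickening (δ := δ) (E := A₀)).isClosed_compl ?_ hz ?_
        · exact disjoint_left.2 fun p hp hpA => hp (Metric.self_subset_thickening hδ _ hpA)
        · filter_upwards [eventually_ge_atTop 0] with t ht hzt
          exact hzB t ht (inter_mem_nhdsWithin_of_mem_thickening
            (hN.inv_subset_interior _ (hz.mapsTo t ht)) hzt))
  refine ⟨_, _, inter_subset_left, inter_subset_left, hNA, hNR, ?_⟩
  obtain ⟨ε, hε, hball⟩ := Metric.mem_nhdsWithin_iff.1 ((eventually_isIsolatingNhd hX hF hN).and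
    ((eventually_isIsolatingNhd hX hF hisoA).and ((eventually_isIsolatingNhd hX hF hisoR).and
      (hflow.and hfwd))))
  refine ⟨ε, hε, fun l hl hlε => ?_⟩
  obtain ⟨h1, h2, h3, h4, h5⟩ := hball ⟨by simpa using hlε, hl⟩
  refine ⟨h1, h2, h3, ?_⟩
  exact (isCompactInvariant_inv hX hF hNc hN.subset hl).isAttractorRepellerPair_and_isRepeller h2 h3
    inter_subset_left inter_subset_left (hdisj.mono inter_subset_right inter_subset_right) h4 h5
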